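/- Let $m,n\ge 0$ be integers, let $\lambda>0$, and let $\alpha_1,\dots,\alpha_n$ be linear forms on $\mathbb R^m$. For $z,w\in\mathbb C^n$ write $zw=\sum_k z_kw_k$, $|z|^2=z\bar z$, and for $t\in\mathbb R^m$ put $t\cdot z=(e^{i\alpha_1(t)}z_1,\dots,e^{i\alpha_n(t)}z_n)$. Let $G$ be the generalized diamond group, i.e. the set $\mathbb R^m\times\mathbb C^n\times\mathbb R$ with the law $$(t,z,c)(t',z',c')=\Bigl(t+t',\ z+t\cdot z',\ c+c'+\tfrac{i}{4}\bigl(z\,\overline{t\cdot z'}-(t\cdot z')\,\bar z\bigr)\Bigr),$$ acting on $\mathbb C^n$ by $(t,z_0,c_0)\cdot z=t\cdot z+z_0$. Let $d\mu_\lambda=(2\pi)^{-n}\lambda^n\,dm$, where $dm$ is Lebesgue measure on $\mathbb C^n$, and let $\mathcal F_\lambda$ be the Fock space of all holomorphic functions $f$ on $\mathbb C^n$ with $\int|f(z)|^2e^{-\lambda|z|^2/2}\,d\mu_\lambda(z)<\infty$, with inner product $\langle f,h\rangle=\int f\,\bar h\,e^{-\lambda|z|^2/2}\,d\mu_\lambda$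 and coherent states $e_z(w)=e^{\lambda\bar zw/2}$. Let $\chi$ be a unitary character of $\mathbb R^m$, and let $\pi$ be the unitary representation of $G$ on $\mathcal F_\lambda$ given by $$(\pi(t,z_0,c_0)f)(z)=\chi(t)\exp\bigl(i\lambda c_0+\tfrac\lambda2\bar z_0z-\tfrac\lambda4|z_0|^2\bigr)f\bigl((-t)\cdot(z-z_0)\bigr).$$ Let $A$ be a linear operator on $\mathcal F_\lambda$, bounded or not, whose domain contains all coherent states. Let $k_A(z,w)=\langle Ae_w,e_z\rangle$ be its kernel, and let $$W_0(A)(z)=2^n\int_{\mathbb C^n}k_A(z+w,z-w)\exp\bigl(\tfrac\lambda2(-z\bar z-w\bar w+z\bar w-\bar zw)\bigr)\,d\mu_\lambda(w)$$ be its complex Weyl symbol, defined at the points $z$ where the integral converges absolutely. Then, for every $g\in G$, the domain of the operator $\pi(g)^{-1}A\pi(g)$ (that is, $\{f:\pi(g)f\in\operatorname{dom}A\}$) contains all coherent states, and for every $z\in\mathbb C^n$ the integral defining $W_0(\pi(g)^{-1}A\pi(g))(z)$ converges absolutely if and only if the one defining $W_0(A)(g\cdot z)$ does, and $$W_0(\pi(g)^{-1}A\pi(g))(z)=W_0(A)(g\cdot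 z).$$ -/

import Mathlib

open MeasureTheory Complex
open scoped ComplexConjugate

noncomputable section

namespace GenDiamond

/-! ### The pairing on `ℂⁿ` and the measures -/

/-- The bilinear pairing `z w = ∑ₖ zₖ wₖ` on `ℂⁿ`. -/
def pair {n : ℕ} (z w : Fin n → ℂ) : ℂ := ∑ k, z k * w k

/-- The coordinatewise complex conjugate `z̄`. -/
def cbar {n : ℕ} (z : Fin n → ℂ) : Fin n → ℂ := fun k => conj (z k)

/-- The squared Euclidean norm `|z|² = ∑ₖ |zₖ|²`. -/
def normSq {n : ℕ} (z : Fin n → ℂ) : ℝ := ∑ k, ‖z k‖ ^ 2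

/-- `ω((z,w),(z',w')) = (i/2)(z w' - z' w)`. -/
def omega {n : ℕ} (p q : (Fin n → ℂ) × (Fin n → ℂ)) : ℂ :=
  I / 2 * (pair p.1 q.2 - pair q.1 p.2)

/-- `dμ_λ = (2π)⁻ⁿ λⁿ dm`, with `dm = dx dy` the Lebesgue measure of `ℂⁿ`. -/
def mu (n : ℕ) (lam : ℝ) : Measure (Fin n → ℂ) :=
  ENNReal.ofReal ((2 * Real.pi)⁻¹ ^ n * lam ^ n) • volume

/-- The Gaussian weight `exp(-λ|z|²/2)`. -/
def weight {n : ℕ} (lam : ℝ) (z : Fin n → ℂ) : ℝ := Real.exp (-lam * normSq z / 2)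

lemma continuous_weight {n : ℕ} (lam : ℝ) : Continuous (weight (n := n) lam) := by
  unfold weight normSq
  fun_prop

lemma weight_pos {n : ℕ} (lam : ℝ) (z : Fin n → ℂ) : 0 < weight lam z := Real.exp_pos _

/-! ### The Fock space -/

/-- Square integrability with respect to the Gaussian weight. -/
def SqInt {n : ℕ} (lam : ℝ) (f : (Fin n → ℂ) → ℂ) : Prop :=
  Integrable (fun z => ‖f z‖ ^ 2 * weight lam z) (mu n lam)

lemma integrable_mul {n : ℕ} {lam : ℝ} {f g : (Fin n → ℂ) → ℂ}
    (hf : Continuous f) (hg : Continuous g) (hf2 : SqInt lam f) (hg2 : SqInt lam g) :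
    Integrable (fun z => conj (f z) * g z * (weight lam z : ℂ)) (mu n lam) := by
  have hw := continuous_weight (n := n) lam
  refine (Integrable.add hf2 hg2).mono' ?_ (Filter.Eventually.of_forall fun z => ?_)
  · exact Continuous.aestronglyMeasurable (by fun_prop)
  · have h0 := weight_pos lam z
    simp only [norm_mul, RCLike.norm_conj, Complex.norm_real, Real.norm_eq_abs, abs_of_pos h0,
      Pi.add_apply]
    rw [← add_mul]
    refine mul_le_mul_of_nonneg_right ?_ h0.le
    nlinarith [sq_nonneg (‖f z‖ - ‖g z‖), sq_nonneg ‖f z‖, sq_nonneg ‖g z‖]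

lemma SqInt.add {n : ℕ} {lam : ℝ} {f g : (Fin n → ℂ) → ℂ}
    (hf : Continuous f) (hg : Continuous g) (hf2 : SqInt lam f) (hg2 : SqInt lam g) :
    SqInt lam (f + g) := by
  have hw := continuous_weight (n := n) lam
  refine ((Integrable.add hf2 hg2).const_mul 2).mono' ?_ (Filter.Eventually.of_forall fun z => ?_)
  · exact Continuous.aestronglyMeasurable (by simp only [Pi.add_apply]; fun_prop)
  · have h0 := weight_pos lam z
    rw [Real.norm_eq_abs, abs_of_nonneg (by positivity)]
    simp only [Pi.add_apply]
    rw [← add_mul, ← mul_assoc]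
    refine mul_le_mul_of_nonneg_right ?_ h0.le
    have h1 := norm_add_le (f z) (g z)
    nlinarith [sq_nonneg (‖f z‖ - ‖g z‖), norm_nonneg (f z + g z)]

/-- The holomorphic functions `f` on `ℂⁿ` with `∫ |f|² exp(-λ|z|²/2) dμ_λ < ∞`. -/
def fockSubmodule (n : ℕ) (lam : ℝ) : Submodule ℂ ((Fin n → ℂ) → ℂ) where
  carrier := {f | Differentiable ℂ f ∧ SqInt lam f}
  zero_mem' := ⟨differentiable_const 0, by simp [SqInt]⟩
  add_mem' := fun hf hg =>
    ⟨hf.1.add hg.1, SqInt.add hf.1.continuous hg.1.continuous hf.2 hg.2⟩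
  smul_mem' := fun c f hf => ⟨hf.1.const_smul c, by
    have := Integrable.const_mul hf.2 (‖c‖ ^ 2)
    refine this.congr (Filter.Eventually.of_forall fun z => ?_)
    simp only [Pi.smul_apply, smul_eq_mul, norm_mul]
    ring⟩

/-- The Fock space `𝓕_λ`. A type synonym, so that it does not inherit the topology of pointwise
convergence. -/
def Fock (n : ℕ) (lam : ℝ) : Type := fockSubmodule n lam

instance (n : ℕ) (lam : ℝ) : AddCommGroup (Fock n lam) :=
  inferInstanceAs (AddCommGroup (fockSubmodule n lam))

instance (n : ℕ) (lam : ℝ) : Module ℂ (Fock n lam) :=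
  inferInstanceAs (Module ℂ (fockSubmodule n lam))

/-- The function underlying an element of the Fock space. -/
def Fock.toFun {n : ℕ} {lam : ℝ} (f : Fock n lam) : (Fin n → ℂ) → ℂ :=
  Subtype.val (p := fun g => g ∈ fockSubmodule n lam) f

instance (n : ℕ) (lam : ℝ) : CoeFun (Fock n lam) (fun _ => (Fin n → ℂ) → ℂ) :=
  ⟨Fock.toFun⟩

/-- A holomorphic square integrable function as an element of the Fock space. -/
def Fock.mk {n : ℕ} {lam : ℝ} (f : (Fin n → ℂ) → ℂ) (hf : Differentiable ℂ f)
    (hf2 : SqInt lam f) : Fock n lam :=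
  (⟨f, hf, hf2⟩ : fockSubmodule n lam)

lemma Fock.mk_apply {n : ℕ} {lam : ℝ} (f : (Fin n → ℂ) → ℂ) (hf : Differentiable ℂ f)
    (hf2 : SqInt lam f) (z : Fin n → ℂ) : Fock.mk f hf hf2 z = f z := rfl

lemma Fock.add_apply {n : ℕ} {lam : ℝ} (f g : Fock n lam) (z : Fin n → ℂ) :
    (f + g) z = f z + g z := rfl

lemma Fock.smul_apply {n : ℕ} {lam : ℝ} (c : ℂ) (f : Fock n lam) (z : Fin n → ℂ) :
    (c • f) z = c * f z := rfl

lemma Fock.differentiable {n : ℕ} {lam : ℝ} (f : Fock n lam) : Differentiable ℂ f := f.2.1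

lemma Fock.sqInt {n : ℕ} {lam : ℝ} (f : Fock n lam) : SqInt lam f := f.2.2

lemma Fock.ext {n : ℕ} {lam : ℝ} {f g : Fock n lam} (h : ∀ z, f z = g z) : f = g :=
  Subtype.ext (funext h)

lemma Fock.integrable_mul {n : ℕ} {lam : ℝ} (f g : Fock n lam) :
    Integrable (fun z => conj (f z) * g z * (weight lam z : ℂ)) (mu n lam) :=
  GenDiamond.integrable_mul f.differentiable.continuous g.differentiable.continuous f.sqInt g.sqInt

lemma mu_isOpenPos (n : ℕ) (lam : ℝ) (hlam : 0 < lam) : (mu n lam).IsOpenPosMeasure := by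
  refine ⟨fun U hU hne => ?_⟩
  have h1 : 0 < (2 * Real.pi)⁻¹ ^ n * lam ^ n := by positivity
  have h2 : (volume : Measure (Fin n → ℂ)) U ≠ 0 := (hU.measure_pos volume hne).ne'
  simp only [mu, Measure.smul_apply, smul_eq_mul]
  exact mul_ne_zero (by simpa using h1) h2

lemma self_integrand {n : ℕ} {lam : ℝ} (f : Fock n lam) :
    (fun z => conj (f z) * f z * (weight lam z : ℂ))
      = fun z => ((‖f z‖ ^ 2 * weight lam z : ℝ) : ℂ) := by
  funext z
  rw [mul_comm (conj (f z)), Complex.mul_conj, Complex.normSq_eq_norm_sq]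
  push_cast
  ring

/-- The inner product `⟨f, h⟩ = ∫ f h̄ exp(-λ|z|²/2) dμ_λ`, in the convention of `inner`, which is
conjugate linear in the first variable: `inner ℂ f h = ⟨h, f⟩`. -/
@[reducible]
def fockCore (n : ℕ) (lam : ℝ) [hlam : Fact (0 < lam)] :
    InnerProductSpace.Core ℂ (Fock n lam) where
  inner f h := ∫ z, conj (f z) * h z * (weight lam z : ℂ) ∂(mu n lam)
  conj_inner_symm f h := by
    rw [← integral_conj]
    refine integral_congr_ae (Filter.Eventually.of_forall fun z => ?_)
    simp only [map_mul, Complex.conj_conj, Complex.conj_ofReal]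
    ring
  re_inner_nonneg f := by
    rw [self_integrand, integral_complex_ofReal]
    simp only [RCLike.re_to_complex, Complex.ofReal_re]
    exact integral_nonneg fun z => mul_nonneg (sq_nonneg _) (weight_pos lam z).le
  add_left f g h := by
    rw [← integral_add (f.integrable_mul h) (g.integrable_mul h)]
    refine integral_congr_ae (Filter.Eventually.of_forall fun z => ?_)
    simp only [Fock.add_apply, map_add]
    ring
  smul_left f h r := by
    rw [← integral_const_mul]
    refine integral_congr_ae (Filter.Eventually.of_forall fun z => ?_)
    simp only [Fock.smul_apply, map_mul]
    ring
  definite f hf := by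
    have hpos := mu_isOpenPos n lam hlam.out
    change ∫ z, conj (f z) * f z * (weight lam z : ℂ) ∂(mu n lam) = 0 at hf
    rw [self_integrand, integral_complex_ofReal] at hf
    have hf' : ∫ z, ‖f z‖ ^ 2 * weight lam z ∂(mu n lam) = 0 := by exact_mod_cast hf
    rw [integral_eq_zero_iff_of_nonneg
      (fun z => mul_nonneg (sq_nonneg _) (weight_pos lam z).le) f.sqInt] at hf'
    have hc : Continuous fun z => ‖f z‖ ^ 2 * weight lam z :=
      (f.differentiable.continuous.norm.pow 2).mul (continuous_weight lam)
    have h0 := (hc.ae_eq_iff_eq (mu n lam) continuous_const).1 hf'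
    refine Fock.ext fun z => ?_
    have hz : ‖f z‖ ^ 2 * weight lam z = 0 := congrFun h0 z
    have hn : ‖f z‖ = 0 := by
      simpa [(weight_pos lam z).ne'] using hz
    exact norm_eq_zero.1 hn

instance (n : ℕ) (lam : ℝ) [Fact (0 < lam)] : NormedAddCommGroup (Fock n lam) :=
  (fockCore n lam).toNormedAddCommGroup

instance (n : ℕ) (lam : ℝ) [Fact (0 < lam)] : InnerProductSpace ℂ (Fock n lam) :=
  InnerProductSpace.ofCore (fockCore n lam).toCore

lemma Fock.inner_def {n : ℕ} {lam : ℝ} [Fact (0 < lam)] (f h : Fock n lam) :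
    inner ℂ f h = ∫ z, conj (f z) * h z * (weight lam z : ℂ) ∂(mu n lam) := rfl

/-! ### Coherent states -/

lemma sqInt_coherent {n : ℕ} {lam : ℝ} (hlam : 0 < lam) (z : Fin n → ℂ) :
    SqInt lam (fun w => cexp (lam * pair (cbar z) w / 2)) := by
  have h1 : ∀ k : Fin n, Integrable
      (fun v : ℂ => Real.exp (-(lam / 2) * ‖v‖ ^ 2 + lam * inner ℝ (z k) v)) := by
    intro k
    have h := GaussianFourier.integrable_cexp_neg_mul_sq_norm_add (V := ℂ) (b := (lam / 2 : ℝ))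
      (by simpa using hlam) (lam : ℂ) (z k)
    refine h.norm.congr (Filter.Eventually.of_forall fun v => ?_)
    simp only [Complex.norm_exp]
    congr 1
    norm_cast
  have h2 := Integrable.fintype_prod (𝕜 := ℝ) h1
  refine Integrable.smul_measure (Integrable.congr h2 (Filter.Eventually.of_forall fun w => ?_))
    ENNReal.ofReal_ne_top
  simp only [weight]
  rw [← Real.exp_sum, Complex.norm_exp, ← Real.exp_nat_mul, ← Real.exp_add]
  congr 1
  have h3 : (lam * pair (cbar z) w / 2 : ℂ).re = lam * (∑ k, inner ℝ (z k) (w k)) / 2 := by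
    have : (lam * pair (cbar z) w / 2 : ℂ) = ((lam / 2 : ℝ) : ℂ) * pair (cbar z) w := by
      push_cast; ring
    rw [this, Complex.re_ofReal_mul]
    simp only [pair, cbar, Complex.re_sum, Complex.inner]
    simp only [mul_comm (w _)]
    ring
  rw [h3, Finset.sum_add_distrib, ← Finset.mul_sum, ← Finset.mul_sum]
  simp only [normSq]
  push_cast
  ring

/-- The coherent state `e_z(w) = exp(λ z̄ w / 2)`. -/
def coherent {n : ℕ} (lam : ℝ) [hlam : Fact (0 < lam)] (z : Fin n → ℂ) : Fock n lam :=
  Fock.mk (fun w => cexp (lam * pair (cbar z) w / 2)) (by unfold pair; fun_prop)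
    (sqInt_coherent hlam.out z)

/-! ### The generalized diamond group and its action on `ℂⁿ` -/

/-- `t · z = (e^{iα₁(t)} z₁, …, e^{iαₙ(t)} zₙ)`. -/
def tact {m n : ℕ} (α : Fin n → Module.Dual ℝ (Fin m → ℝ)) (t : Fin m → ℝ) (z : Fin n → ℂ) :
    Fin n → ℂ := fun k => cexp (I * (α k t : ℝ)) * z k

/-- The generalized diamond group, with underlying set `ℝᵐ × ℂⁿ × ℝ`. -/
@[ext]
structure Diamond {m n : ℕ} (α : Fin n → Module.Dual ℝ (Fin m → ℝ)) where
  t : Fin m → ℝ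
  z : Fin n → ℂ
  c : ℝ

section Group

variable {m n : ℕ} {α : Fin n → Module.Dual ℝ (Fin m → ℝ)}

/-- The group law of the semi-direct product of `ℝᵐ` and the Heisenberg group,
`(t,z,c)(t',z',c') = (t+t', z + t·z', c + c' + ½ ω((z,z̄),(t·z', conj(t·z'))))`; the number
`ω((z,z̄),(w,w̄))` is real. -/
instance : Mul (Diamond α) :=
  ⟨fun g h => ⟨g.t + h.t, g.z + tact α g.t h.z,
    g.c + h.c + (omega (g.z, cbar g.z) (tact α g.t h.z, cbar (tact α g.t h.z))).re / 2⟩⟩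

instance : One (Diamond α) := ⟨⟨0, 0, 0⟩⟩

instance : Inv (Diamond α) := ⟨fun g => ⟨-g.t, -tact α (-g.t) g.z, -g.c⟩⟩

lemma mul_t (g h : Diamond α) : (g * h).t = g.t + h.t := rfl
lemma mul_z (g h : Diamond α) : (g * h).z = g.z + tact α g.t h.z := rfl
lemma mul_c (g h : Diamond α) : (g * h).c = g.c + h.c +
    (omega (g.z, cbar g.z) (tact α g.t h.z, cbar (tact α g.t h.z))).re / 2 := rfl
lemma one_t : (1 : Diamond α).t = 0 := rfl
lemma one_z : (1 : Diamond α).z = 0 := rfl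
lemma one_c : (1 : Diamond α).c = 0 := rfl
lemma inv_t (g : Diamond α) : g⁻¹.t = -g.t := rfl
lemma inv_z (g : Diamond α) : g⁻¹.z = -tact α (-g.t) g.z := rfl
lemma inv_c (g : Diamond α) : g⁻¹.c = -g.c := rfl

lemma tact_add (s t : Fin m → ℝ) (z : Fin n → ℂ) :
    tact α (s + t) z = tact α s (tact α t z) := by
  funext k
  simp only [tact, map_add, Complex.ofReal_add, mul_add, Complex.exp_add]
  ring

lemma tact_zero (z : Fin n → ℂ) : tact α 0 z = z := by
  funext k
  simp [tact]

lemma tact_zero_right (t : Fin m → ℝ) : tact α t 0 = 0 := by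
  funext k
  simp [tact]

lemma tact_vadd (t : Fin m → ℝ) (z w : Fin n → ℂ) :
    tact α t (z + w) = tact α t z + tact α t w := by
  funext k
  simp [tact, mul_add]

lemma tact_neg (t : Fin m → ℝ) (z : Fin n → ℂ) : tact α t (-z) = -tact α t z := by
  funext k
  simp [tact]

lemma pair_cbar_tact (t : Fin m → ℝ) (z w : Fin n → ℂ) :
    pair (tact α t z) (cbar (tact α t w)) = pair z (cbar w) := by
  unfold pair
  refine Finset.sum_congr rfl fun k _ => ?_
  have h : cexp (I * (α k t : ℝ)) * conj (cexp (I * (α k t : ℝ))) = 1 := by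
    rw [Complex.mul_conj, Complex.normSq_eq_norm_sq, mul_comm I, Complex.norm_exp_ofReal_mul_I]
    simp
  simp only [tact, cbar, map_mul]
  linear_combination (z k * conj (w k)) * h

lemma pair_add_left (a b w : Fin n → ℂ) : pair (a + b) w = pair a w + pair b w := by
  simp [pair, add_mul, Finset.sum_add_distrib]

lemma pair_add_right (a b w : Fin n → ℂ) : pair w (a + b) = pair w a + pair w b := by
  simp [pair, mul_add, Finset.sum_add_distrib]

lemma pair_neg_left (a w : Fin n → ℂ) : pair (-a) w = -pair a w := by
  simp [pair]

lemma pair_neg_right (a w : Fin n → ℂ) : pair w (-a) = -pair w a := by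
  simp [pair]

lemma pair_comm (a w : Fin n → ℂ) : pair a w = pair w a := by
  simp [pair, mul_comm]

lemma cbar_add (a b : Fin n → ℂ) : cbar (a + b) = cbar a + cbar b := by
  funext k
  simp [cbar]

lemma cbar_neg (a : Fin n → ℂ) : cbar (-a) = -cbar a := by
  funext k
  simp [cbar]

instance : Group (Diamond α) where
  mul_assoc a b c := by
    ext1
    · simp only [mul_t, add_assoc]
    · simp only [mul_z, mul_t, tact_vadd, tact_add, add_assoc]
    · simp only [mul_c, mul_z, mul_t, tact_vadd, tact_add, omega, cbar_add, pair_add_left,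
        pair_add_right, pair_cbar_tact]
      rw [show I / 2 * (pair a.z (cbar (tact α a.t b.z)) + pair a.z (cbar (tact α a.t (tact α b.t c.z)))
          - (pair (tact α a.t b.z) (cbar a.z) + pair (tact α a.t (tact α b.t c.z)) (cbar a.z)))
          = I / 2 * (pair a.z (cbar (tact α a.t b.z)) - pair (tact α a.t b.z) (cbar a.z))
          + I / 2 * (pair a.z (cbar (tact α a.t (tact α b.t c.z)))
            - pair (tact α a.t (tact α b.t c.z)) (cbar a.z)) by ring]
      rw [show I / 2 * (pair a.z (cbar (tact α a.t (tact α b.t c.z)))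
          + pair b.z (cbar (tact α b.t c.z))
          - (pair (tact α a.t (tact α b.t c.z)) (cbar a.z) + pair (tact α b.t c.z) (cbar b.z)))
          = I / 2 * (pair a.z (cbar (tact α a.t (tact α b.t c.z)))
            - pair (tact α a.t (tact α b.t c.z)) (cbar a.z))
          + I / 2 * (pair b.z (cbar (tact α b.t c.z)) - pair (tact α b.t c.z) (cbar b.z)) by ring]
      simp only [Complex.add_re]
      ring
  one_mul a := by
    ext1
    · simp [mul_t, one_t]
    · simp [mul_z, one_z, one_t, tact_zero]
    · simp [mul_c, one_c, one_z, omega, pair, cbar]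
  mul_one a := by
    ext1
    · simp [mul_t, one_t]
    · simp [mul_z, one_z, tact_zero_right]
    · simp [mul_c, one_c, one_z, omega, pair, cbar, tact_zero_right]
  inv_mul_cancel a := by
    ext1
    · simp [mul_t, one_t, inv_t]
    · simp [mul_z, inv_z, inv_t, one_z]
    · simp [mul_c, inv_z, inv_t, inv_c, one_c, omega, cbar_neg, pair_neg_left, pair_neg_right]

/-- The action `(t,z₀,c₀) · z = t·z + z₀` of the group on `ℂⁿ`. -/
instance : MulAction (Diamond α) (Fin n → ℂ) where
  smul g z := tact α g.t z + g.z
  one_smul z := by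
    change tact α 0 z + 0 = z
    rw [tact_zero, add_zero]
  mul_smul g h z := by
    change tact α (g.t + h.t) z + (g.z + tact α g.t h.z) = tact α g.t (tact α h.t z + h.z) + g.z
    rw [tact_add, tact_vadd]
    abel

lemma smul_def (g : Diamond α) (z : Fin n → ℂ) : g • z = tact α g.t z + g.z := rfl

end Group

/-! ### The representation `π` -/

section Rep

variable {m n : ℕ} {α : Fin n → Module.Dual ℝ (Fin m → ℝ)}

lemma inv_smul_eq (g : Diamond α) (z : Fin n → ℂ) : g⁻¹ • z = tact α (-g.t) (z - g.z) := by
  rw [smul_def, inv_t, inv_z, sub_eq_add_neg, tact_vadd, tact_neg]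

lemma measurePreserving_smul (lam : ℝ) (g : Diamond α) :
    MeasurePreserving (fun z : Fin n → ℂ => g • z) (mu n lam) (mu n lam) := by
  have h1 : MeasurePreserving (fun z : Fin n → ℂ => tact α g.t z) volume volume := by
    refine volume_preserving_pi fun k => ?_
    have h : MeasurePreserving (rotation (Circle.exp (α k g.t))) (volume : Measure ℂ) volume :=
      (rotation (Circle.exp (α k g.t))).measurePreserving
    have e : (fun z : ℂ => cexp (I * (α k g.t : ℝ)) * z) = rotation (Circle.exp (α k g.t)) := by
      funext z
      simp [rotation_apply, Circle.coe_exp, mul_comm I]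
    rw [← e] at h
    exact h
  have h2 := (measurePreserving_add_right (volume : Measure (Fin n → ℂ)) g.z).comp h1
  exact h2.smul_measure _

lemma measurableEmbedding_smul (g : Diamond α) :
    MeasurableEmbedding (fun z : Fin n → ℂ => g • z) := by
  have hc : ∀ g : Diamond α, Continuous (fun z : Fin n → ℂ => g • z) := by
    intro g
    have h : Continuous (tact α g.t) := by
      unfold tact
      fun_prop
    exact h.add continuous_const
  exact (Homeomorph.mk (MulAction.toPerm g) (hc g) (hc g⁻¹)).measurableEmbedding

lemma normSq_eq_pair (z : Fin n → ℂ) : (normSq z : ℂ) = pair z (cbar z) := by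
  simp only [normSq, pair, cbar, Complex.mul_conj, Complex.normSq_eq_norm_sq]
  push_cast
  rfl

/-- The factor `χ(t) exp(iλc₀ + (λ/2) z̄₀ z - (λ/4)|z₀|²)`. -/
def piFactor (χ : AddChar (Fin m → ℝ) Circle) (lam : ℝ) (g : Diamond α) (z : Fin n → ℂ) : ℂ :=
  (χ g.t : ℂ) *
    cexp (I * lam * g.c + lam / 2 * pair (cbar g.z) z - lam / 4 * (normSq g.z : ℝ))

lemma cbar_cbar (z : Fin n → ℂ) : cbar (cbar z) = z := by
  funext k
  simp [cbar]

lemma conj_pair (z w : Fin n → ℂ) : conj (pair z w) = pair (cbar z) (cbar w) := by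
  simp [pair, cbar]

lemma piFactor_weight (χ : AddChar (Fin m → ℝ) Circle) (lam : ℝ) (g : Diamond α)
    (z : Fin n → ℂ) :
    conj (piFactor χ lam g z) * piFactor χ lam g z * (weight lam z : ℂ)
      = (weight lam (g⁻¹ • z) : ℂ) := by
  have hχ : conj (χ g.t : ℂ) * (χ g.t : ℂ) = 1 := by
    rw [mul_comm, Complex.mul_conj, Complex.normSq_eq_norm_sq, Circle.norm_coe]
    simp
  have hn : (normSq (g⁻¹ • z) : ℂ)
      = normSq z - pair (cbar g.z) z - pair g.z (cbar z) + normSq g.z := by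
    rw [inv_smul_eq]
    simp only [normSq_eq_pair, pair_cbar_tact, sub_eq_add_neg, cbar_add, cbar_neg, pair_add_left,
      pair_add_right, pair_neg_left, pair_neg_right]
    rw [pair_comm z (cbar g.z)]
    ring
  simp only [piFactor, weight, map_mul, ← Complex.exp_conj, Complex.ofReal_exp]
  rw [show ∀ a b c d e : ℂ, a * b * (c * d) * e = (a * c) * (b * d * e) by intros; ring, hχ,
    one_mul, ← Complex.exp_add, ← Complex.exp_add]
  congr 1
  push_cast
  rw [hn]
  simp only [map_add, map_sub, map_mul, map_div₀, Complex.conj_I, Complex.conj_ofReal, conj_pair,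
    cbar_cbar, map_ofNat]
  ring

lemma piFactor_integrand (χ : AddChar (Fin m → ℝ) Circle) (lam : ℝ) (g : Diamond α)
    (f h : (Fin n → ℂ) → ℂ) (z : Fin n → ℂ) :
    conj (piFactor χ lam g z * f (g⁻¹ • z)) * (piFactor χ lam g z * h (g⁻¹ • z))
        * (weight lam z : ℂ)
      = conj (f (g⁻¹ • z)) * h (g⁻¹ • z) * (weight lam (g⁻¹ • z) : ℂ) := by
  rw [← piFactor_weight χ lam g z, map_mul]
  ring

lemma sqInt_pi (χ : AddChar (Fin m → ℝ) Circle) (lam : ℝ) (g : Diamond α) (f : Fock n lam) :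
    SqInt lam (fun z => piFactor χ lam g z * f (tact α (-g.t) (z - g.z))) := by
  have h := ((measurePreserving_smul lam g⁻¹).integrable_comp_emb
    (measurableEmbedding_smul g⁻¹)).2 f.sqInt
  refine h.congr (Filter.Eventually.of_forall fun z => ?_)
  have key := piFactor_integrand χ lam g f f z
  simp only [Function.comp_apply]
  rw [← inv_smul_eq]
  have e : ∀ (a : ℂ) (r : ℝ), conj a * a * (r : ℂ) = ((‖a‖ ^ 2 * r : ℝ) : ℂ) := by
    intro a r
    rw [mul_comm (conj a), Complex.mul_conj, Complex.normSq_eq_norm_sq]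
    push_cast
    ring
  rw [e, e] at key
  exact_mod_cast key.symm

/-- The operator `π(t,z₀,c₀)`:
`(π(t,z₀,c₀) f)(z) = χ(t) exp(iλc₀ + (λ/2) z̄₀ z - (λ/4)|z₀|²) f(t⁻¹·(z - z₀))`. -/
def piLin (χ : AddChar (Fin m → ℝ) Circle) (lam : ℝ) (g : Diamond α) :
    Fock n lam →ₗ[ℂ] Fock n lam where
  toFun f := Fock.mk (fun z => piFactor χ lam g z * f (tact α (-g.t) (z - g.z)))
    (by
      have h1 : Differentiable ℂ (piFactor χ lam g) := by
        unfold piFactor pair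
        fun_prop
      have h2 : Differentiable ℂ (fun z : Fin n → ℂ => tact α (-g.t) (z - g.z)) := by
        unfold tact
        fun_prop
      exact h1.mul (f.differentiable.comp h2))
    (sqInt_pi χ lam g f)
  map_add' f h := by
    refine Fock.ext fun z => ?_
    simp only [Fock.mk_apply, Fock.add_apply, mul_add]
  map_smul' c f := by
    refine Fock.ext fun z => ?_
    simp only [Fock.mk_apply, Fock.smul_apply, RingHom.id_apply]
    ring

lemma piLin_apply (χ : AddChar (Fin m → ℝ) Circle) (lam : ℝ) (g : Diamond α) (f : Fock n lam)
    (z : Fin n → ℂ) :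
    piLin χ lam g f z = piFactor χ lam g z * f (g⁻¹ • z) := by
  rw [inv_smul_eq]
  rfl

lemma piFactor_mul (χ : AddChar (Fin m → ℝ) Circle) (lam : ℝ) (g h : Diamond α)
    (z : Fin n → ℂ) :
    piFactor χ lam (g * h) z = piFactor χ lam g z * piFactor χ lam h (g⁻¹ • z) := by
  have hω : (((omega (g.z, cbar g.z) (tact α g.t h.z, cbar (tact α g.t h.z))).re : ℝ) : ℂ)
      = omega (g.z, cbar g.z) (tact α g.t h.z, cbar (tact α g.t h.z)) := by
    rw [← Complex.conj_eq_iff_re]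
    simp only [omega, map_mul, map_sub, map_div₀, Complex.conj_I, conj_pair, cbar_cbar, map_ofNat]
    rw [pair_comm (cbar g.z), pair_comm (cbar (tact α g.t h.z))]
    ring
  have h1 : pair (cbar h.z) (g⁻¹ • z) = pair (cbar (tact α g.t h.z)) (z - g.z) := by
    rw [inv_smul_eq, pair_comm, pair_comm (cbar (tact α g.t h.z)),
      ← pair_cbar_tact (α := α) g.t (tact α (-g.t) (z - g.z)) h.z, ← tact_add, add_neg_cancel,
      tact_zero]
  have h2 : (normSq (g * h).z : ℂ) = normSq g.z + pair g.z (cbar (tact α g.t h.z))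
      + pair (tact α g.t h.z) (cbar g.z) + normSq h.z := by
    simp only [normSq_eq_pair, mul_z, cbar_add, pair_add_left, pair_add_right, pair_cbar_tact]
    ring
  simp only [piFactor]
  rw [mul_t, AddChar.map_add_eq_mul, Circle.coe_mul, h1, h2, mul_c, mul_z,
    show ∀ a b c d : ℂ, a * b * (c * d) = a * c * (b * d) by intros; ring, ← Complex.exp_add]
  congr 2
  push_cast
  rw [hω]
  simp only [omega, cbar_add, pair_add_left, sub_eq_add_neg, pair_add_right, pair_neg_right]
  rw [pair_comm g.z (cbar (tact α g.t h.z))]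
  linear_combination (lam / 4 * (pair (cbar (tact α g.t h.z)) g.z
    - pair (tact α g.t h.z) (cbar g.z))) * Complex.I_mul_I

lemma piLin_mul (χ : AddChar (Fin m → ℝ) Circle) (lam : ℝ) (g h : Diamond α) (f : Fock n lam) :
    piLin χ lam (g * h) f = piLin χ lam g (piLin χ lam h f) := by
  refine Fock.ext fun z => ?_
  rw [piLin_apply, piLin_apply, piLin_apply, piFactor_mul, mul_inv_rev, mul_smul, mul_assoc]

lemma piLin_one (χ : AddChar (Fin m → ℝ) Circle) (lam : ℝ) (f : Fock n lam) :
    piLin χ lam (1 : Diamond α) f = f := by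
  refine Fock.ext fun z => ?_
  rw [piLin_apply]
  simp [piFactor, one_t, one_z, one_c, pair, cbar, normSq]

lemma inner_piLin (χ : AddChar (Fin m → ℝ) Circle) (lam : ℝ) [Fact (0 < lam)] (g : Diamond α)
    (f h : Fock n lam) : inner ℂ (piLin χ lam g f) (piLin χ lam g h) = inner ℂ f h := by
  rw [Fock.inner_def, Fock.inner_def, ← (measurePreserving_smul lam g⁻¹).integral_comp
    (measurableEmbedding_smul g⁻¹) (fun z => conj (f z) * h z * (weight lam z : ℂ))]
  refine integral_congr_ae (Filter.Eventually.of_forall fun z => ?_)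
  simp only [piLin_apply]
  exact piFactor_integrand χ lam g f h z

/-- The unitary representation `π` of the generalized diamond group on the Fock space attached to
`λ > 0` and a unitary character `χ` of `ℝᵐ`. -/
def rep (χ : AddChar (Fin m → ℝ) Circle) (lam : ℝ) [Fact (0 < lam)] :
    Diamond α →* (Fock n lam ≃ₗᵢ[ℂ] Fock n lam) where
  toFun g := LinearEquiv.isometryOfInner
    (LinearEquiv.ofLinearMap (piLin χ lam g) (piLin χ lam g⁻¹)
      (LinearMap.ext fun f => by
        simp only [LinearMap.comp_apply, ← piLin_mul, mul_inv_cancel, piLin_one,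
          LinearMap.id_apply])
      (LinearMap.ext fun f => by
        simp only [LinearMap.comp_apply, ← piLin_mul, inv_mul_cancel, piLin_one,
          LinearMap.id_apply]))
    (inner_piLin χ lam g)
  map_one' := LinearIsometryEquiv.ext fun f => piLin_one χ lam f
  map_mul' g h := LinearIsometryEquiv.ext fun f => piLin_mul χ lam g h f

end Rep

/-! ### Operators, kernels and the complex Weyl correspondence -/

section Weyl

variable {n : ℕ} {lam : ℝ} [Fact (0 < lam)]

/-- The operator `U⁻¹ A U`, with its natural domain `{f | U f ∈ dom A}`. -/
def conjOp (U : Fock n lam ≃ₗᵢ[ℂ] Fock n lam) (A : Fock n lam →ₗ.[ℂ] Fock n lam) :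
    Fock n lam →ₗ.[ℂ] Fock n lam where
  domain := A.domain.comap U.toLinearEquiv.toLinearMap
  toFun :=
    { toFun := fun f => U.symm (A ⟨U f.1, f.2⟩)
      map_add' := fun f h => by
        rw [← map_add, ← LinearPMap.map_add]
        congr 2
        exact Subtype.ext (map_add U f.1 h.1)
      map_smul' := fun c f => by
        rw [RingHom.id_apply, ← map_smul, ← LinearPMap.map_smul]
        congr 2
        exact Subtype.ext (map_smul U c f.1) }

/-- The domain of the (possibly unbounded) operator `A` contains all coherent states, that is,
`A` has a kernel `k_A`. For everywhere defined operators this is automatic. -/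
def HasKernel (A : Fock n lam →ₗ.[ℂ] Fock n lam) : Prop :=
  ∀ w : Fin n → ℂ, coherent lam w ∈ A.domain

/-- The kernel `k_A(z,w) = ⟨A e_w, e_z⟩` (linear in the first entry of the bracket). -/
def kernel (A : Fock n lam →ₗ.[ℂ] Fock n lam) (hA : HasKernel A) (z w : Fin n → ℂ) : ℂ :=
  inner ℂ (coherent lam z) (A ⟨coherent lam w, hA w⟩)

/-- The integrand
`k_A(z+w, z-w) exp((λ/2)(-z z̄ - w w̄ + z w̄ - z̄ w))` of the complex Weyl correspondence. -/
def weylIntegrand (A : Fock n lam →ₗ.[ℂ] Fock n lam) (hA : HasKernel A) (z w : Fin n → ℂ) : ℂ :=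
  kernel A hA (z + w) (z - w) *
    cexp (lam / 2 * (-pair z (cbar z) - pair w (cbar w) + pair z (cbar w) - pair (cbar z) w))

/-- The integral defining `W₀(A)(z)` converges. -/
def WeylConverges (A : Fock n lam →ₗ.[ℂ] Fock n lam) (hA : HasKernel A) (z : Fin n → ℂ) : Prop :=
  Integrable (weylIntegrand A hA z) (mu n lam)

/-- The complex Weyl symbol
`W₀(A)(z) = 2ⁿ ∫ k_A(z+w, z-w) exp((λ/2)(-z z̄ - w w̄ + z w̄ - z̄ w)) dμ_λ(w)`. -/
def W0 (A : Fock n lam →ₗ.[ℂ] Fock n lam) (hA : HasKernel A) (z : Fin n → ℂ) : ℂ :=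
  2 ^ n * ∫ w, weylIntegrand A hA z w ∂(mu n lam)

end Weyl

end GenDiamond

end

/-! Coherent states form a single orbit of `π` up to scalars: `π(g) e_w` is a nonzero multiple of
`e_{g·w}`, because rotations are unitary and a translation only adds a linear term to the exponent
(`rep_coherent`). Since a domain is a subspace, conjugating by `π(g)` keeps all coherent states in
it. Since `π(g)` is unitary, the kernel of `π(g)⁻¹ A π(g)` at `(z, w)` is the kernel of `A` at
`(g·z, g·w)` times two scalars (`kernel_conjOp`), whose product is an explicit Gaussian factor free
of `χ` and `c₀` (`conj_cocycle_mul_cocycle`).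

The Weyl integrand evaluates the kernel at `z + w` and `z - w`. The action is affine with linear
part the rotation by `t`, so these points go to `g·z + t·w` and `g·z - t·w`: the midpoint moves by
`g` and the half-difference by `t` alone. The Gaussian weight in the definition of `W₀` is such that
its change under `(z, w) ↦ (g·z, t·w)` is exactly the factor produced by the kernel. Hence the
integrands agree pointwise (`weylIntegrand_conjOp`), and substituting `t·w` for `w`, which preserves
`μ_λ`, gives both the equivalence of convergence and the equality of symbols. -/

namespace GenDiamond

/-! ### Covariance of coherent states, kernels and the Weyl integrand -/

section Covariance

variable {m n : ℕ} {α : Fin n → Module.Dual ℝ (Fin m → ℝ)}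

/-- The scalar by which `π(g) e_w` differs from `e_{g · w}`. -/
noncomputable def cocycle (χ : AddChar (Fin m → ℝ) Circle) (lam : ℝ) (g : Diamond α) (w : Fin n → ℂ) : ℂ :=
  (χ g.t : ℂ) * cexp (I * lam * g.c - lam / 4 * (normSq g.z : ℝ)
    - lam / 2 * pair (cbar (tact α g.t w)) g.z)

/-- The rotation by `t` is unitary for the Hermitian pairing, so `-t` on one side passes to the
other side as `t`. -/
lemma pair_cbar_inv_smul (g : Diamond α) (w z : Fin n → ℂ) :
    pair (cbar w) (g⁻¹ • z) = pair (cbar (tact α g.t w)) (z - g.z) := by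
  rw [inv_smul_eq, pair_comm, pair_comm (cbar (tact α g.t w)),
    ← pair_cbar_tact (α := α) g.t (tact α (-g.t) (z - g.z)) w, ← tact_add, add_neg_cancel,
    tact_zero]

/-- The part of the exponent linear in `z` is `λ/2` times the pairing of `z` with the conjugate of
`t·w + z₀ = g·w`; the terms constant in `z` make up the cocycle. -/
lemma rep_coherent (χ : AddChar (Fin m → ℝ) Circle) (lam : ℝ) [Fact (0 < lam)]
    (g : Diamond α) (w : Fin n → ℂ) :
    rep χ lam g (coherent lam w) = cocycle χ lam g w • coherent lam (g • w) := by
  refine Fock.ext fun z => ?_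
  change piLin χ lam g (coherent lam w) z = _
  rw [piLin_apply, Fock.smul_apply]
  simp only [coherent, Fock.mk_apply, piFactor, cocycle]
  rw [mul_assoc (χ g.t : ℂ), mul_assoc (χ g.t : ℂ), ← Complex.exp_add, ← Complex.exp_add,
    pair_cbar_inv_smul, smul_def]
  congr 2
  simp only [cbar_add, pair_add_left, sub_eq_add_neg, pair_add_right, pair_neg_right]
  ring

lemma hasKernel_conjOp (χ : AddChar (Fin m → ℝ) Circle) {lam : ℝ} [Fact (0 < lam)]
    (g : Diamond α) {A : Fock n lam →ₗ.[ℂ] Fock n lam} (hA : HasKernel A) :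
    HasKernel (conjOp (rep χ lam g) A) := by
  intro w
  change rep χ lam g (coherent lam w) ∈ A.domain
  rw [rep_coherent]
  exact A.domain.smul_mem _ (hA _)

lemma kernel_conjOp (χ : AddChar (Fin m → ℝ) Circle) {lam : ℝ} [Fact (0 < lam)]
    (g : Diamond α) {A : Fock n lam →ₗ.[ℂ] Fock n lam} (hA : HasKernel A) (z w : Fin n → ℂ) :
    kernel (conjOp (rep χ lam g) A) (hasKernel_conjOp χ g hA) z w
      = conj (cocycle χ lam g z) * cocycle χ lam g w * kernel A hA (g • z) (g • w) := by
  -- `A` is only partially defined, so the scalar must be extracted inside `A.domain` before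
  -- linearity applies.
  have hdom : (⟨rep χ lam g (coherent lam w), hasKernel_conjOp χ g hA w⟩ : A.domain)
      = cocycle χ lam g w • ⟨coherent lam (g • w), hA (g • w)⟩ :=
    Subtype.ext (rep_coherent χ lam g w)
  change inner ℂ (coherent lam z) ((rep χ lam g).symm
    (A ⟨rep χ lam g (coherent lam w), hasKernel_conjOp χ g hA w⟩)) = _
  -- Applying the isometry `π(g)` to both entries cancels `π(g)⁻¹` and turns `e_z` into a multiple
  -- of `e_{g·z}`; `inner` is conjugate linear in its first entry, so the scalar at `z` comes out
  -- conjugated.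
  rw [← (rep χ lam g).inner_map_map, LinearIsometryEquiv.apply_symm_apply, hdom,
    LinearPMap.map_smul, rep_coherent, inner_smul_left, inner_smul_right, kernel, mul_assoc]

/-- The unimodular factors `χ(t)` and `exp(iλc₀)` do not depend on the point, so they cancel against
their conjugates. -/
lemma conj_cocycle_mul_cocycle (χ : AddChar (Fin m → ℝ) Circle) (lam : ℝ) (g : Diamond α)
    (z w : Fin n → ℂ) :
    conj (cocycle χ lam g z) * cocycle χ lam g w
      = cexp (-(lam / 2) * (pair g.z (cbar g.z) + pair (tact α g.t z) (cbar g.z)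
          + pair (cbar (tact α g.t w)) g.z)) := by
  have hχ : conj (χ g.t : ℂ) * (χ g.t : ℂ) = 1 := by
    rw [mul_comm, Complex.mul_conj, Complex.normSq_eq_norm_sq, Circle.norm_coe]
    simp
  simp only [cocycle, map_mul, ← Complex.exp_conj]
  rw [show ∀ a b c d : ℂ, a * b * (c * d) = (a * c) * (b * d) by intros; ring, hχ, one_mul,
    ← Complex.exp_add, ← normSq_eq_pair]
  congr 1
  simp only [map_sub, map_mul, map_div₀, Complex.conj_I, Complex.conj_ofReal, conj_pair,
    cbar_cbar, map_ofNat]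
  ring

lemma weylIntegrand_conjOp (χ : AddChar (Fin m → ℝ) Circle) {lam : ℝ} [Fact (0 < lam)]
    (g : Diamond α) {A : Fock n lam →ₗ.[ℂ] Fock n lam} (hA : HasKernel A) (z w : Fin n → ℂ) :
    weylIntegrand (conjOp (rep χ lam g) A) (hasKernel_conjOp χ g hA) z w
      = weylIntegrand A hA (g • z) (tact α g.t w) := by
  have hadd : g • (z + w) = g • z + tact α g.t w := by
    simp only [smul_def, tact_vadd]
    abel
  have hsub : g • (z - w) = g • z - tact α g.t w := by
    simp only [smul_def, sub_eq_add_neg, tact_vadd, tact_neg]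
    abel
  rw [weylIntegrand, weylIntegrand, kernel_conjOp χ g hA, conj_cocycle_mul_cocycle, hadd, hsub,
    mul_comm (cexp _), mul_assoc, ← Complex.exp_add]
  congr 2
  -- Unitarity rewrites the untransformed exponent in terms of `t·z` and `t·w`. Both sides are then
  -- polynomials in the same pairings, once each conjugate is moved to the second slot.
  rw [← pair_cbar_tact (α := α) g.t z z, ← pair_cbar_tact (α := α) g.t w w,
    ← pair_cbar_tact (α := α) g.t z w, pair_comm (cbar z), ← pair_cbar_tact (α := α) g.t w z]
  simp only [smul_def, sub_eq_add_neg, tact_vadd, tact_neg, cbar_add, cbar_neg, pair_add_left,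
    pair_add_right, pair_neg_left]
  simp only [pair_comm (cbar _)]
  ring

end Covariance

end GenDiamond

/-! ### Change of variables in the Weyl integral -/

open GenDiamond in
theorem mainTheorem3 {m n : ℕ} (α : Fin n → Module.Dual ℝ (Fin m → ℝ))
    (χ : AddChar (Fin m → ℝ) Circle) (lam : ℝ) [Fact (0 < lam)]
    (A : GenDiamond.Fock n lam →ₗ.[ℂ] GenDiamond.Fock n lam) (hA : GenDiamond.HasKernel A)
    (g : GenDiamond.Diamond α) :
    ∃ hA' : GenDiamond.HasKernel (GenDiamond.conjOp (GenDiamond.rep χ lam g) A),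
      ∀ z : Fin n → ℂ,
        (GenDiamond.WeylConverges (GenDiamond.conjOp (GenDiamond.rep χ lam g) A) hA' z ↔
          GenDiamond.WeylConverges A hA (g • z)) ∧
        GenDiamond.W0 (GenDiamond.conjOp (GenDiamond.rep χ lam g) A) hA' z =
          GenDiamond.W0 A hA (g • z) := by
  refine ⟨hasKernel_conjOp χ g hA, fun z => ?_⟩
  -- The rotation by `t` is the action of the group element `(t, 0, 0)`, so invariance of `μ_λ`
  -- under the group covers it.
  have hrot : (fun w : Fin n → ℂ => (⟨g.t, 0, 0⟩ : Diamond α) • w) = tact α g.t := by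
    funext w
    simp only [smul_def, add_zero]
  have hmp := measurePreserving_smul lam (⟨g.t, 0, 0⟩ : Diamond α)
  have hemb := measurableEmbedding_smul (⟨g.t, 0, 0⟩ : Diamond α)
  rw [hrot] at hmp hemb
  have hint : weylIntegrand (conjOp (rep χ lam g) A) (hasKernel_conjOp χ g hA) z
      = weylIntegrand A hA (g • z) ∘ tact α g.t :=
    funext (weylIntegrand_conjOp χ g hA z)
  constructor
  · rw [WeylConverges, WeylConverges, hint, hmp.integrable_comp_emb hemb]
  · rw [W0, W0, hint]
    simp only [Function.comp_apply]
    -- This needs no integrability: where the integrals diverge, both sides take the default value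
    -- `0`.
    rw [hmp.integral_comp hemb]
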